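/- **Definitions.** Let $P$ be a quasi-ordered set (or class) with order $\leqq_P$. For a countable $A\subseteq P$ with the inherited order, let $$\vec A=\{X\in A^{\omega} : X(k)\nleqq_P X(k+1)\ \text{for all } k\in\omega\},$$ a Polish space under pointwise convergence ($A$ being discrete), and let $S:\vec A\to\vec A$, $S(X)(k)=X(k+1)$, be the shift. Regard $\vec A$ as the graph in which two distinct points $X,Y$ are adjacent iff $S(X)=Y$ or $S(Y)=X$. Its Borel chromatic number $\chi_B(\vec A)$ is the least cardinality of a Polish space $Y$ for which there is a Borel map $\vec A\to Y$ that sends adjacent points to distinct points. Call $P$ *thin* if $\chi_B(\vec A)\le 3$ for every countable $A\subseteq P$; if $P$ is countable, this just says $\chi_B(\vec P)\le 3$. (A thin quasi-order is automatically a better-quasi-order.) A *tree* is a partial order $(T,\leq_T)$ with a least element, the root, such that $\{v\in T: v\leq_T t\}$ is well ordered for every $t\in T$. It has *height* $\leq\omega$ if every $t\in T$ has only finitely many predecessors. For a quasi-order $Q$, let $\mathcal T_Q$ be the class of all pairs $(T,l)$, where $T$ is a tree of height $\leq\omega$, of any cardinality, and $l:T\to Q$ is any function. Put $(T_1,l_1)\leqq_1(T_2,l_2)$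 iff there is a map $f:T_1\to T_2$ such that $x<_{T_1}y$ implies $f(x)<_{T_2}f(y)$ for all $x,y\in T_1$, and $l_1(x)\leqq_Q l_2(f(x))$ for all $x\in T_1$. **Theorem 3.10.** If $Q$ is thin, then the class $\mathcal T_Q$, quasi-ordered by $\leqq_1$, is thin. -/

import Mathlib

universe u v w

/-! ### Borel chromatic numbers -/

/-- `G ≼_B H`: there is a Borel map between the vertex spaces that sends edges to edges. -/
def BorelGraphHom {V : Type u} {W : Type w} [TopologicalSpace V] [TopologicalSpace W]
    (G : SimpleGraph V) (H : SimpleGraph W) : Prop :=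
  ∃ f : V → W, @Measurable V W (borel V) (borel W) f ∧ ∀ x y, G.Adj x y → H.Adj (f x) (f y)

/-- The Borel chromatic number of a graph `G` on a Polish space `V`: the least cardinality of a
Polish space `Y` such that `G` has a Borel homomorphism to the complete graph on `Y`.
(For Polish `V`, the space `Y = V` itself is a candidate, so the infimum is a minimum.) -/
noncomputable def borelChromaticNumber {V : Type u} [TopologicalSpace V] (G : SimpleGraph V) :
    Cardinal.{u} :=
  sInf {c : Cardinal.{u} | ∃ (Y : Type u) (_ : TopologicalSpace Y),
    PolishSpace Y ∧ BorelGraphHom G (⊤ : SimpleGraph Y) ∧ Cardinal.mk Y = c}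

/-- The graph generated by a function `f : V → V`: distinct `x`, `y` are joined iff
`f x = y` or `f y = x`. -/
def functionGraph {V : Type u} (f : V → V) : SimpleGraph V where
  Adj x y := x ≠ y ∧ (f x = y ∨ f y = x)
  symm := ⟨fun _ _ h => ⟨h.1.symm, h.2.symm⟩⟩
  loopless := ⟨fun _ h => h.1 rfl⟩

/-! ### The shift graph of a quasi-order, and thinness -/

/-- The space of all sequences `X` in `P` with `X k ≰ X (k + 1)` for every `k`. -/
def BadSeq (P : Type u) [Preorder P] : Type u :=
  {X : ℕ → P // ∀ k, ¬ X k ≤ X (k + 1)}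

/-- The topology of pointwise convergence, where `P` itself is discrete. -/
instance BadSeq.instTopologicalSpace (P : Type u) [Preorder P] : TopologicalSpace (BadSeq P) :=
  letI : TopologicalSpace P := ⊥
  TopologicalSpace.induced (fun X : BadSeq P => X.1) Pi.topologicalSpace

/-- The shift, which drops the first term of a sequence. -/
def BadSeq.shift {P : Type u} [Preorder P] (X : BadSeq P) : BadSeq P :=
  ⟨fun k => X.1 (k + 1), fun k => X.2 (k + 1)⟩

/-- A quasi-order `P` is thin if for every countable `A ⊆ P`, with the inherited order, the graph
generated by the shift on the sequences `X` in `A` with `X k ≰ X (k + 1)` for all `k` has Borel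
chromatic number at most `3`. For countable `P` this says the same as the case `A = P`. -/
def IsThin (P : Type u) [Preorder P] : Prop :=
  ∀ A : Set P, A.Countable →
    borelChromaticNumber (functionGraph (BadSeq.shift : BadSeq A → BadSeq A)) ≤ 3

/-! ### Labelled trees -/

/-- A `Q`-labelled tree of height at most `ω`: a partial order with a least element (the root), in
which the elements below any given one are well ordered, every element has only finitely many
strict predecessors (that is, the height is at most `ω`), and every element has a label in `Q`.
No bound is put on the cardinality of the tree or on its branching. -/
structure LabelledTree (Q : Type u) : Type (max u (v + 1)) where
  carrier : Type v
  [order : PartialOrder carrier]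
  root : carrier
  root_le : ∀ t, root ≤ t
  wellOrder_below : ∀ t : carrier, IsWellOrder (Set.Iic t) (· < ·)
  height_le_omega : ∀ t : carrier, (Set.Iio t).Finite
  label : carrier → Q

attribute [instance] LabelledTree.order

/-- The order `≤₁` on labelled trees: there is a map that preserves the strict tree order and
does not decrease labels. -/
def LabelledTree.LE₁ {Q : Type u} [Preorder Q] (S T : LabelledTree.{u, v} Q) : Prop :=
  ∃ f : S.carrier → T.carrier,
    (∀ x y, x < y → f x < f y) ∧ ∀ x, S.label x ≤ T.label (f x)

/-- The class of `Q`-labelled trees of height at most `ω`, quasi-ordered by `≤₁`. -/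
instance LabelledTree.instPreorder {Q : Type u} [Preorder Q] :
    Preorder (LabelledTree.{u, v} Q) where
  le := LabelledTree.LE₁
  le_refl _ := ⟨id, fun _ _ h => h, fun _ => le_rfl⟩
  le_trans _ _ _ := fun ⟨f, hf, hf'⟩ ⟨g, hg, hg'⟩ =>
    ⟨g ∘ f, fun _ _ h => hg _ _ (hf _ _ h), fun x => (hf' x).trans (hg' (f x))⟩

/-! If `S ≰ T`, the first player wins the climbing game on `S` and `T`: otherwise the answers of the
second player form an embedding (`nonempty_strategy`). Fix one winning strategy per pair. Given a
sequence `X` of trees, each not below the next, play the games on all consecutive pairs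
simultaneously, the first player's moves in each game serving as the answers in the preceding one.
Every play is finite, so the moves on the first tree stabilise to a finite nonempty list. Its list
of labels is a Borel function of `X`, being an eventual value of functions of finitely many terms.

Let `D` be the set of those `X` whose label list, without its last entry, is dominated by a
subsequence of the label list of `X.shift`, without its last entry. On `D` the last label of `X` is
not below that of `X.shift` (`not_lastLabel_le`), so an orbit inside `D` yields a bad sequence in a
countable part of `Q`, and thinness of `Q` colours it. No orbit avoids `D`
(`exists_iterate_sublistForall₂`). Orbits that eventually stay in `D` inherit a colouring, and those
that enter and leave `D` infinitely often have a Borel three-colouring in any case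
(`exists_coloring_of_split`). -/

/-! ### Measurable three-colourings of a function -/

/-- Add to the colour at the first point in `E` the number of steps needed to reach it: before
entry, each step changes the colour by one. Points that never enter get the harmless time `0`. -/
theorem exists_coloring_of_eventually {V : Type*} [MeasurableSpace V] {S : V → V}
    (hS : Measurable S) {E : Set V} (hE : MeasurableSet E) (hSE : ∀ x ∈ E, S x ∈ E)
    {c : V → ZMod 3} (hc : Measurable c) (hcE : ∀ x ∈ E, c x ≠ c (S x)) :
    ∃ d : V → ZMod 3, Measurable d ∧ ∀ x, (∃ n, S^[n] x ∈ E) → d x ≠ d (S x) := by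
  classical
  have hp : ∀ x, ∃ n, S^[n] x ∈ E ∨ ∀ m, S^[m] x ∉ E := fun x => by
    by_cases h : ∃ n, S^[n] x ∈ E
    · exact h.imp fun n hn => Or.inl hn
    · exact ⟨0, Or.inr (not_exists.1 h)⟩
  have hm : ∀ n, MeasurableSet {x | S^[n] x ∈ E} := fun n => (hS.iterate n) hE
  refine ⟨fun x => c (S^[Nat.find (hp x)] x) + (Nat.find (hp x) : ℕ),
    Measurable.find (f := fun n x => c (S^[n] x) + (n : ZMod 3))
      (p := fun n x => S^[n] x ∈ E ∨ ∀ m, S^[m] x ∉ E)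
      (fun n => (hc.comp (hS.iterate n)).add_const _) (fun n => ?_) hp, ?_⟩
  · have h : MeasurableSet {x | ∀ m, S^[m] x ∉ E} := by
      rw [Set.ofPred_forall]
      exact MeasurableSet.iInter fun m => (hm m).compl
    exact (hm n).union h
  · rintro x ⟨n, hn⟩
    by_cases hx : x ∈ E
    · have h0 : Nat.find (hp x) = 0 := (Nat.find_eq_zero _).2 (Or.inl hx)
      have h1 : Nat.find (hp (S x)) = 0 := (Nat.find_eq_zero _).2 (Or.inl (hSE x hx))
      simpa [h0, h1] using hcE x hx
    · have h0 : Nat.find (hp x) = Nat.find (hp (S x)) + 1 := by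
        rw [Nat.find_eq_iff]
        have hn' : ∃ m, S^[m] (S x) ∈ E := by
          cases n with
          | zero => exact absurd hn hx
          | succ n => exact ⟨n, hn⟩
        refine ⟨Or.inl ?_, fun k hk => ?_⟩
        · rcases Nat.find_spec (hp (S x)) with h | h
          · exact h
          · exact absurd hn'.choose_spec (h _)
        · rintro (h | h)
          · cases k with
            | zero => exact hx h
            | succ k => exact Nat.find_min (hp (S x)) (Nat.lt_of_succ_lt_succ hk) (Or.inl h)
          · exact h n hn
      dsimp only
      rw [h0, Function.iterate_succ_apply]
      push_cast
      rw [← add_assoc]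
      simp

/-- Colour by the parity of the time left until the orbit next crosses the boundary of `D`, using
`0, 1` inside and `2, 1` outside. The last point before a crossing has time `1`, hence the colour
`0` or `2` that the other side never uses. -/
theorem exists_coloring_of_recurrent {V : Type*} [MeasurableSpace V] {S : V → V}
    (hS : Measurable S) {D : Set V} (hD : MeasurableSet D) :
    ∃ d : V → ZMod 3, Measurable d ∧
      ∀ x, (∀ m, ∃ n, S^[n] (S^[m] x) ∈ D) → (∀ m, ∃ n, S^[n] (S^[m] x) ∉ D) → d x ≠ d (S x) := by
  classical
  have hp : ∀ x, ∃ n, (S^[n] x ∈ D ↔ x ∉ D) ∨ ∀ m, ¬ (S^[m] x ∈ D ↔ x ∉ D) := fun x => by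
    by_cases h : ∃ n, (S^[n] x ∈ D ↔ x ∉ D)
    · exact h.imp fun n hn => Or.inl hn
    · exact ⟨0, Or.inr (not_exists.1 h)⟩
  have hm : ∀ n, MeasurableSet {x | S^[n] x ∈ D ↔ x ∉ D} := fun n =>
    MeasurableSet.iff ((hS.iterate n) hD) hD.compl
  let f : ℕ → V → ZMod 3 := fun n x =>
    if x ∈ D then (if Odd n then 0 else 1) else (if Odd n then 2 else 1)
  refine ⟨fun x => f (Nat.find (hp x)) x,
    Measurable.find (f := f)
      (p := fun n x => (S^[n] x ∈ D ↔ x ∉ D) ∨ ∀ m, ¬ (S^[m] x ∈ D ↔ x ∉ D))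
      (fun n => Measurable.ite hD measurable_const measurable_const) (fun n => ?_) hp, ?_⟩
  · have h : MeasurableSet {x | ∀ m, ¬ (S^[m] x ∈ D ↔ x ∉ D)} := by
      rw [Set.ofPred_forall]
      exact MeasurableSet.iInter fun m => (hm m).compl
    exact (hm n).union h
  · intro x h1 h2
    have hex : ∀ m, ∃ n, S^[n] (S^[m] x) ∈ D ↔ S^[m] x ∉ D := fun m => by
      by_cases h : S^[m] x ∈ D
      · obtain ⟨n, hn⟩ := h2 m
        exact ⟨n, by tauto⟩
      · obtain ⟨n, hn⟩ := h1 m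
        exact ⟨n, by tauto⟩
    have hx := (Nat.find_spec (hp x)).resolve_right (not_forall_not.2 (hex 0))
    have hSx := (Nat.find_spec (hp (S x))).resolve_right (not_forall_not.2 (hex 1))
    have hmin : ∀ k < Nat.find (hp x), ¬ (S^[k] x ∈ D ↔ x ∉ D) := fun k hk h =>
      Nat.find_min (hp x) hk (Or.inl h)
    have hmin' : ∀ k < Nat.find (hp (S x)), ¬ (S^[k] (S x) ∈ D ↔ S x ∉ D) := fun k hk h =>
      Nat.find_min (hp (S x)) hk (Or.inl h)
    have hpos : Nat.find (hp x) ≠ 0 := fun h => by rw [h] at hx; simp at hx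
    by_cases hch : (S x ∈ D ↔ x ∉ D)
    · have h0 : Nat.find (hp x) = 1 := (Nat.find_eq_iff _).2 ⟨Or.inl hch, fun k hk => by
        obtain rfl : k = 0 := by omega
        exact Nat.find_min (hp x) (Nat.pos_of_ne_zero hpos)⟩
      dsimp only
      rw [h0]
      by_cases hxD : x ∈ D <;>
        simp only [hxD, not_true_eq_false, not_false_eq_true, iff_false, iff_true] at hch <;>
        simp only [f, hxD, hch, if_true, if_false, odd_one] <;> split_ifs <;> decide
    · have h0 : Nat.find (hp x) = Nat.find (hp (S x)) + 1 := by
        rw [Nat.find_eq_iff]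
        refine ⟨Or.inl ?_, fun k hk => ?_⟩
        · rw [Function.iterate_succ_apply]; tauto
        · rintro (h | h)
          · cases k with
            | zero => simp at h
            | succ k =>
              refine hmin' k (Nat.lt_of_succ_lt_succ hk) ?_
              rw [Function.iterate_succ_apply] at h; tauto
          · exact h _ hx
      dsimp only
      rw [h0]
      by_cases hxD : x ∈ D <;>
        simp only [hxD, not_true_eq_false, not_false_eq_true, iff_false, iff_true, not_not] at hch <;>
        simp only [f, hxD, hch, Nat.odd_add_one, if_true, if_false, not_true_eq_false,
          not_false_eq_true] <;>
        split_ifs <;> first | contradiction | decide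

/-- A measurable function `S` has a measurable proper colouring with three colours as soon as it
has one on the points whose orbits stay inside `D`, and one on those whose orbits avoid `D`. -/
theorem exists_coloring_of_split {V : Type*} [MeasurableSpace V] {S : V → V}
    (hS : Measurable S) {D : Set V} (hD : MeasurableSet D) {c₁ c₂ : V → ZMod 3}
    (hc₁ : Measurable c₁) (h₁ : ∀ x, (∀ n, S^[n] x ∈ D) → c₁ x ≠ c₁ (S x))
    (hc₂ : Measurable c₂) (h₂ : ∀ x, (∀ n, S^[n] x ∉ D) → c₂ x ≠ c₂ (S x)) :
    ∃ d : V → ZMod 3, Measurable d ∧ ∀ x, d x ≠ d (S x) := by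
  classical
  have key : ∀ F : Set V, MeasurableSet F → MeasurableSet {x | ∀ n, S^[n] x ∈ F} := fun F hF => by
    rw [Set.ofPred_forall]
    exact MeasurableSet.iInter fun n => (hS.iterate n) hF
  have key' : ∀ F : Set V, MeasurableSet F → MeasurableSet {x | ∃ n, S^[n] x ∈ F} := fun F hF => by
    rw [Set.ofPred_exists]
    exact MeasurableSet.iUnion fun n => (hS.iterate n) hF
  have inv : ∀ F : Set V, ∀ x ∈ {x | ∀ n, S^[n] x ∈ F}, S x ∈ {x | ∀ n, S^[n] x ∈ F} :=
    fun F x hx n => hx (n + 1)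
  have inv' : ∀ F : Set V, (∀ x ∈ F, S x ∈ F) → ∀ x,
      (∃ n, S^[n] (S x) ∈ F) ↔ ∃ n, S^[n] x ∈ F := fun F hF x => by
    refine ⟨fun ⟨n, hn⟩ => ⟨n + 1, hn⟩, fun ⟨n, hn⟩ => ⟨n, ?_⟩⟩
    rw [← Function.iterate_succ_apply, Function.iterate_succ_apply']
    exact hF _ hn
  obtain ⟨d₁, hd₁, hd₁'⟩ := exists_coloring_of_eventually hS (key D hD) (inv D) hc₁ h₁
  obtain ⟨d₂, hd₂, hd₂'⟩ := exists_coloring_of_eventually hS (key Dᶜ hD.compl) (inv Dᶜ) hc₂ h₂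
  obtain ⟨d₃, hd₃, hd₃'⟩ := exists_coloring_of_recurrent hS hD
  refine ⟨fun x => if ∃ n, S^[n] x ∈ {x | ∀ n, S^[n] x ∈ D} then d₁ x else
    if ∃ n, S^[n] x ∈ {x | ∀ n, S^[n] x ∈ Dᶜ} then d₂ x else d₃ x,
    Measurable.ite (key' _ (key D hD)) hd₁ (Measurable.ite (key' _ (key _ hD.compl)) hd₂ hd₃), ?_⟩
  intro x
  simp only [inv' _ (inv D), inv' _ (inv Dᶜ)]
  split_ifs with h h'
  · exact hd₁' x h
  · exact hd₂' x h'
  · refine hd₃' x (fun m => ?_) (fun m => ?_)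
    · by_contra hcon
      exact h' ⟨m, fun n hn => hcon ⟨n, hn⟩⟩
    · by_contra hcon
      exact h ⟨m, fun n => by_contra fun hn => hcon ⟨n, hn⟩⟩

/-! ### Thinness in terms of measurable colourings -/

theorem borelChromaticNumber_le_three {V : Type u} [TopologicalSpace V] {G : SimpleGraph V}
    {c : V → ZMod 3} (hc : @Measurable _ _ (borel V) _ c) (hG : ∀ x y, G.Adj x y → c x ≠ c y) :
    borelChromaticNumber G ≤ 3 := by
  refine csInf_le' ?_ |>.trans_eq (b := Cardinal.mk (ULift.{u} (ZMod 3))) ?_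
  · let t : TopologicalSpace (ULift.{u} (ZMod 3)) := ⊥
    have : DiscreteTopology (ULift.{u} (ZMod 3)) := ⟨rfl⟩
    have : Finite (ULift.{u} (ZMod 3)) := inferInstanceAs (Finite (ULift (Fin 3)))
    refine ⟨_, t, inferInstance, ⟨fun x => ⟨c x⟩, ?_, fun x y h => ?_⟩, rfl⟩
    · exact fun s _ => hc (t := ULift.up ⁻¹' s) trivial
    · simpa using hG x y h
  · rw [Cardinal.mk_uLift, Cardinal.mk_fintype, ZMod.card]; simp

/-- The hypothesis `hY` makes the set of candidates nonempty, so that its infimum is attained; the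
infimum of the empty set would be `0`. -/
theorem exists_coloring_of_borelChromaticNumber_le_three {V Y : Type u} [TopologicalSpace V]
    {G : SimpleGraph V} [TopologicalSpace Y] [PolishSpace Y]
    (hY : BorelGraphHom G (⊤ : SimpleGraph Y)) (h : borelChromaticNumber G ≤ 3) :
    ∃ c : V → ZMod 3, @Measurable _ _ (borel V) _ c ∧ ∀ x y, G.Adj x y → c x ≠ c y := by
  obtain ⟨Z, tZ, hZ, ⟨f, hf, hfG⟩, hcard⟩ := csInf_mem (s := {c : Cardinal.{u} |
    ∃ (Y : Type u) (_ : TopologicalSpace Y),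
      PolishSpace Y ∧ BorelGraphHom G (⊤ : SimpleGraph Y) ∧ Cardinal.mk Y = c})
    ⟨_, Y, _, inferInstance, hY, rfl⟩
  have hle : Cardinal.lift.{0} (Cardinal.mk Z) ≤ Cardinal.lift.{u} (Cardinal.mk (ZMod 3)) := by
    rw [Cardinal.lift_id', hcard, Cardinal.mk_fintype, ZMod.card]
    exact le_of_le_of_eq (b := 3) h (by simp)
  obtain ⟨e⟩ := Cardinal.lift_mk_le'.1 hle
  have : Finite (ZMod 3) := inferInstanceAs (Finite (Fin 3))
  have : Countable Z := e.injective.countable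
  let mZ : MeasurableSpace Z := borel Z
  have : BorelSpace Z := ⟨rfl⟩
  have he : Measurable e := measurable_of_countable e
  exact ⟨fun x => e (f x), @Measurable.comp _ _ _ (borel V) _ _ _ _ he hf,
    fun x y hxy => e.injective.ne (hfG x y hxy)⟩

namespace BadSeq

variable {P : Type u} [Preorder P]

instance : MeasurableSpace (BadSeq P) := borel _

instance : BorelSpace (BadSeq P) := ⟨rfl⟩

theorem ne_shift (X : BadSeq P) : X ≠ X.shift := fun h =>
  X.2 0 (le_of_eq (congrFun (congrArg Subtype.val h) 0))

theorem continuous_apply (k : ℕ) :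
    @Continuous (BadSeq P) P _ ⊥ (fun X => X.1 k) := by
  let : TopologicalSpace P := ⊥
  exact (_root_.continuous_apply k).comp continuous_induced_dom

theorem measurable_apply (k : ℕ) : @Measurable (BadSeq P) P _ ⊤ (fun X => X.1 k) := by
  intro s _
  exact (@IsOpen.preimage _ _ _ ⊥ _ (continuous_apply k) s trivial).measurableSet

theorem measurable_mk [Countable P] {V : Type*} [MeasurableSpace V] {f : V → BadSeq P}
    (hf : ∀ k, @Measurable _ _ _ ⊤ (fun x => (f x).1 k)) : Measurable f := by
  let : TopologicalSpace P := ⊥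
  have : DiscreteTopology P := ⟨rfl⟩
  let : MeasurableSpace P := ⊤
  have : BorelSpace P := ⟨borel_eq_top_of_discrete.symm⟩
  have h : borel (BadSeq P) =
      MeasurableSpace.comap (fun X : BadSeq P => X.1) MeasurableSpace.pi := by
    rw [BorelSpace.measurable_eq (α := ℕ → P)]
    exact borel_comap
  change @Measurable _ _ _ (borel (BadSeq P)) f
  rw [h, measurable_comap_iff, measurable_pi_iff]
  exact hf

theorem measurable_shift [Countable P] : Measurable (shift : BadSeq P → BadSeq P) :=
  measurable_mk fun k => measurable_apply (k + 1)

/-- A function that depends on finitely many terms only has a countable range. -/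
theorem countable_range_of_forall_lt [Countable P] {β : Type*} {f : BadSeq P → β} {n : ℕ}
    (hf : ∀ X Y : BadSeq P, (∀ i < n, X.1 i = Y.1 i) → f X = f Y) : (Set.range f).Countable := by
  have h : Function.FactorsThrough f (fun (X : BadSeq P) (i : Fin n) => X.1 i) := fun X Y h =>
    hf X Y fun i hi => congrFun h ⟨i, hi⟩
  by_cases hne : Nonempty (BadSeq P)
  · obtain ⟨X₀⟩ := hne
    have : Nonempty β := ⟨f X₀⟩
    obtain ⟨g, rfl⟩ := (Function.factorsThrough_iff f).1 h
    exact (Set.countable_range g).mono (Set.range_comp_subset_range _ _)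
  · have := not_nonempty_iff.1 hne
    simp [Set.range_eq_empty]

/-- A function that depends on finitely many terms only is measurable. -/
theorem measurable_of_forall_lt {β : Type*} {f : BadSeq P → β} {n : ℕ}
    (hf : ∀ X Y : BadSeq P, (∀ i < n, X.1 i = Y.1 i) → f X = f Y) :
    @Measurable _ _ _ ⊤ f := by
  intro s _
  refine IsOpen.measurableSet (isOpen_iff_forall_mem_open.2 fun X hX => ?_)
  refine ⟨⋂ i ∈ Set.Iio n, {Y | Y.1 i = X.1 i}, fun Y hY => ?_,
    (Set.finite_Iio n).isOpen_biInter fun i _ => ?_, by simp⟩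
  · have : f Y = f X := hf Y X (by simpa using hY)
    rwa [Set.mem_preimage, this]
  · exact @IsOpen.preimage _ _ _ ⊥ _ (continuous_apply i) {X.1 i} trivial

end BadSeq

theorem isThin_iff {P : Type u} [Preorder P] : IsThin P ↔ ∀ A : Set P, A.Countable →
    ∃ c : BadSeq A → ZMod 3, Measurable c ∧ ∀ X, c X ≠ c X.shift := by
  refine forall₂_congr fun A hA => ⟨fun h => ?_, fun ⟨c, hc, hcX⟩ => ?_⟩
  · have := hA.to_subtype
    let : TopologicalSpace A := ⊥
    have : DiscreteTopology A := ⟨rfl⟩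
    -- The first term of a bad sequence is already a Borel colouring, with countably many colours.
    have hY : BorelGraphHom (functionGraph (BadSeq.shift : BadSeq A → BadSeq A))
        (⊤ : SimpleGraph A) := by
      refine ⟨fun X => X.1 0, ?_, ?_⟩
      · exact (BadSeq.continuous_apply 0).borel_measurable
      · rintro X Y ⟨-, rfl | rfl⟩
        · exact fun h => X.2 0 h.le
        · exact fun h => Y.2 0 h.ge
    obtain ⟨c, hc, hcX⟩ := exists_coloring_of_borelChromaticNumber_le_three hY h
    exact ⟨c, hc, fun X => hcX _ _ ⟨X.ne_shift, Or.inl rfl⟩⟩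
  · refine borelChromaticNumber_le_three hc ?_
    rintro X Y ⟨-, rfl | rfl⟩
    · exact hcX X
    · exact (hcX Y).symm

/-! ### Trees of height at most `ω` and the climbing game -/

namespace LabelledTree

theorem wellFounded_lt {Q : Type u} (S : LabelledTree.{u, v} Q) :
    WellFounded ((· < ·) : S.carrier → S.carrier → Prop) := by
  refine Subrelation.wf (r := InvImage (· < ·) fun x : S.carrier => (Set.Iio x).ncard) ?_
    (InvImage.wf _ Nat.lt_wfRel.wf)
  intro x y h
  exact Set.ncard_lt_ncard ⟨fun z hz => lt_trans hz h, fun h' => lt_irrefl x (h' h)⟩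
    (S.height_le_omega y)

theorem exists_predecessor {Q : Type u} (S : LabelledTree.{u, v} Q) {x : S.carrier} (hx : x ≠ S.root) :
    ∃ p < x, ∀ z < x, z ≤ p := by
  obtain ⟨p, hp⟩ := (S.height_le_omega x).exists_maximal
    ⟨S.root, lt_of_le_of_ne (S.root_le x) hx.symm⟩
  refine ⟨p, hp.prop, fun z hz => ?_⟩
  have := S.wellOrder_below x
  rcases trichotomous_of (α := Set.Iic x) (· < ·) ⟨z, le_of_lt hz⟩ ⟨p, le_of_lt hp.prop⟩ with h | h | h
  · exact le_of_lt h
  · exact (congrArg Subtype.val h).le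
  · exact hp.le_of_ge hz (le_of_lt h)

variable {Q : Type u} [Preorder Q] {S T : LabelledTree.{u, v} Q}

/-- Winning strategies for the first player in the game where the two players climb `S` and `T`.
The first player stands at `x`; the second player has to answer with some `b` above `y` whose label
is at least that of `x`; then the first player moves to some `x' > x`, and so on. The first player
wins when the second player has no answer. -/
inductive Strategy (S T : LabelledTree.{u, v} Q) : S.carrier → WithBot T.carrier → Type (max u v)
  | mk (x : S.carrier) (y : WithBot T.carrier)
      (next : ∀ b : T.carrier, y < b → S.label x ≤ T.label b → S.carrier)
      (lt_next : ∀ b hb hl, x < next b hb hl)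
      (sub : ∀ b hb hl, Strategy S T (next b hb hl) b) : Strategy S T x y

namespace Strategy

def next {x : S.carrier} {y : WithBot T.carrier} : Strategy S T x y →
    ∀ b : T.carrier, y < b → S.label x ≤ T.label b → S.carrier
  | mk _ _ f _ _ => f

theorem lt_next {x : S.carrier} {y : WithBot T.carrier} : ∀ (s : Strategy S T x y)
    (b : T.carrier) (hb : y < b) (hl : S.label x ≤ T.label b), x < s.next b hb hl
  | mk _ _ _ h _ => h

def sub {x : S.carrier} {y : WithBot T.carrier} : ∀ (s : Strategy S T x y)
    (b : T.carrier) (hb : y < b) (hl : S.label x ≤ T.label b), Strategy S T (s.next b hb hl) b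
  | mk _ _ _ _ s => s

open Classical in
/-- The moves of the first player against the second player's moves taken, whenever they are legal,
from a list. -/
noncomputable def respond : List T.carrier → ∀ {x : S.carrier} {y : WithBot T.carrier},
    Strategy S T x y → List S.carrier
  | [], x, _, _ => [x]
  | b :: l, x, y, s =>
    if h : y < (b : WithBot T.carrier) ∧ S.label x ≤ T.label b then
      x :: respond l (s.sub b h.1 h.2)
    else respond l s

theorem respond_cons_pos {x : S.carrier} {y : WithBot T.carrier} (s : Strategy S T x y)
    {b : T.carrier} (l : List T.carrier) (h : y < (b : WithBot T.carrier))
    (h' : S.label x ≤ T.label b) : respond (b :: l) s = x :: respond l (s.sub b h h') := by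
  rw [respond, dif_pos ⟨h, h'⟩]

theorem respond_cons_neg {x : S.carrier} {y : WithBot T.carrier} (s : Strategy S T x y)
    {b : T.carrier} (l : List T.carrier)
    (h : ¬ (y < (b : WithBot T.carrier) ∧ S.label x ≤ T.label b)) :
    respond (b :: l) s = respond l s := by
  rw [respond, dif_neg h]

theorem exists_respond_eq_cons (l : List T.carrier) {x : S.carrier} {y : WithBot T.carrier}
    (s : Strategy S T x y) : ∃ r, respond l s = x :: r := by
  induction l with
  | nil => exact ⟨[], by rw [respond]⟩
  | cons b l ih =>
    rw [respond]
    split_ifs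
    · exact ⟨_, rfl⟩
    · exact ih

theorem respond_ne_nil (l : List T.carrier) {x : S.carrier} {y : WithBot T.carrier}
    (s : Strategy S T x y) : respond l s ≠ [] := by
  obtain ⟨r, hr⟩ := exists_respond_eq_cons l s
  simp [hr]

theorem respond_prefix {l m : List T.carrier} (h : l <+: m) {x : S.carrier}
    {y : WithBot T.carrier} (s : Strategy S T x y) : respond l s <+: respond m s := by
  induction l generalizing m x y with
  | nil =>
    obtain ⟨r, hr⟩ := exists_respond_eq_cons m s
    rw [hr, respond]
    exact ⟨r, rfl⟩
  | cons b l ih =>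
    obtain ⟨n, rfl⟩ := h
    rw [List.cons_append, respond, respond]
    split_ifs
    · exact List.cons_prefix_cons.2 ⟨rfl, ih (List.prefix_append l n) _⟩
    · exact ih (List.prefix_append l n) _

theorem pairwise_respond (l : List T.carrier) {x : S.carrier} {y : WithBot T.carrier}
    (s : Strategy S T x y) : (respond l s).Pairwise (· < ·) ∧ ∀ a ∈ respond l s, x ≤ a := by
  induction l generalizing x y with
  | nil => simp [respond]
  | cons b l ih =>
    rw [respond]
    split_ifs with h
    · have hx := s.lt_next b h.1 h.2
      obtain ⟨h₁, h₂⟩ := ih (s.sub b h.1 h.2)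
      refine ⟨List.pairwise_cons.2 ⟨fun a ha => hx.trans_le (h₂ a ha), h₁⟩, fun a ha => ?_⟩
      rcases List.mem_cons.1 ha with rfl | ha
      · exact le_rfl
      · exact hx.le.trans (h₂ a ha)
    · exact ih s

/-- The response to a chain is not dominated by a subsequence of it. -/
theorem not_sublistForall₂_respond {l : List T.carrier} (hl : l.Pairwise (· < ·)) {x : S.carrier}
    {y : WithBot T.carrier} (hy : ∀ b ∈ l, y < (b : WithBot T.carrier)) (s : Strategy S T x y) :
    ¬ List.SublistForall₂ (fun a b => S.label a ≤ T.label b) (respond l s) l := by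
  induction l generalizing x y with
  | nil => rw [respond]; rintro ⟨⟩
  | cons b l ih =>
    rw [List.pairwise_cons] at hl
    have hyl : ∀ b ∈ l, y < (b : WithBot T.carrier) := fun c hc => hy c (List.mem_cons_of_mem _ hc)
    by_cases hx : S.label x ≤ T.label b
    · have hb := hy b List.mem_cons_self
      rw [respond_cons_pos s l hb hx]
      have hr := ih hl.2 (fun c hc => WithBot.coe_lt_coe.2 (hl.1 c hc)) (s.sub b hb hx)
      -- Whether or not `x` is matched with `b`, the rest of the response would be dominated within
      -- `l`.
      rintro (_ | ⟨-, h⟩ | h)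
      · exact hr h
      · obtain ⟨l', h₁, h₂⟩ := List.sublistForall₂_iff.1 h
        cases h₁ with
        | cons _ h₁ =>
          exact hr (List.sublistForall₂_iff.2 ⟨_, h₁, (List.sublist_cons_self _ _).trans h₂⟩)
    · rw [respond_cons_neg s l fun h => hx h.2]
      have hr := ih hl.2 hyl s
      obtain ⟨r, hs⟩ := exists_respond_eq_cons l s
      rw [hs] at hr ⊢
      rintro (_ | ⟨h, -⟩ | h)
      · exact hx h
      · exact hr h

/-- Every proper initial segment of the response to a list is dominated by a subsequence of it. -/
theorem sublistForall₂_of_prefix_respond {p : List S.carrier} {l : List T.carrier} {x : S.carrier}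
    {y : WithBot T.carrier} (s : Strategy S T x y) (hp : p <+: respond l s)
    (hne : p ≠ respond l s) :
    List.SublistForall₂ (fun a b => S.label a ≤ T.label b) p l := by
  induction l generalizing p x y with
  | nil =>
    rw [respond] at hp hne
    obtain rfl : p = [] := by
      rcases p with _ | ⟨a, p⟩
      · rfl
      · rw [List.cons_prefix_cons, List.prefix_nil] at hp
        exact absurd (by rw [hp.1, hp.2]) hne
    exact .nil
  | cons b l ih =>
    rw [respond] at hp hne
    split_ifs at hp hne with h
    · rcases p with _ | ⟨a, p⟩
      · exact .nil
      · rw [List.cons_prefix_cons] at hp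
        obtain ⟨rfl, hp⟩ := hp
        exact .cons h.2 (ih _ hp fun h => hne (by rw [h]))
    · exact .cons_right (ih s hp hne)

/-- A strategy is a well-founded tree, so no play is infinite. In a chain of lists, the first legal
answer is the same for all lists long enough to contain one; stripping the lists up to it leaves a
chain played against a substrategy. -/
theorem bddAbove_length_respond {x : S.carrier} {y : WithBot T.carrier} (s : Strategy S T x y) :
    ∀ C : Set (List T.carrier), (∀ l ∈ C, ∀ m ∈ C, l <+: m ∨ m <+: l) →
      ∃ N, ∀ l ∈ C, (respond l s).length ≤ N := by
  induction s with
  | mk x y next lt_next sub ih =>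
    intro C hC
    let s : Strategy S T x y := mk x y next lt_next sub
    have skip : ∀ {l m : List T.carrier}, (∀ b ∈ l, ¬ (y < (b : WithBot T.carrier) ∧
        S.label x ≤ T.label b)) → respond (l ++ m) s = respond m s := by
      intro l m hl
      induction l with
      | nil => rfl
      | cons b l ihl =>
        rw [List.cons_append, respond_cons_neg s _ (hl b List.mem_cons_self)]
        exact ihl fun b hb => hl b (List.mem_cons_of_mem _ hb)
    by_cases h : ∃ l b m, (l ++ b :: m ∈ C) ∧ (y < (b : WithBot T.carrier) ∧
        S.label x ≤ T.label b) ∧ ∀ a ∈ l, ¬ (y < (a : WithBot T.carrier) ∧ S.label x ≤ T.label a)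
    · obtain ⟨l, b, m, hlC, hb, hl⟩ := h
      have eq : ∀ m, respond (l ++ b :: m) s = x :: respond m (sub b hb.1 hb.2) := fun m => by
        rw [skip hl, respond_cons_pos s m hb.1 hb.2]; rfl
      obtain ⟨N, hN⟩ := ih b hb.1 hb.2 {m | l ++ b :: m ∈ C} fun m₁ h₁ m₂ h₂ => by
        simpa [List.prefix_append_right_inj] using hC _ h₁ _ h₂
      refine ⟨N + 1, fun k hk => ?_⟩
      rcases hC _ hk _ hlC with h | ⟨n, rfl⟩
      · refine (respond_prefix h s).length_le.trans ?_
        rw [eq, List.length_cons]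
        exact Nat.succ_le_succ (hN m hlC)
      · change (respond _ s).length ≤ _
        rw [List.append_assoc, List.cons_append] at hk ⊢
        rw [eq, List.length_cons]
        exact Nat.succ_le_succ (hN _ hk)
    · refine ⟨1, fun l hl => ?_⟩
      have hall : ∀ b ∈ l, ¬ (y < (b : WithBot T.carrier) ∧ S.label x ≤ T.label b) := by
        intro b hb hxb
        obtain ⟨a, l', m, hl', hf⟩ : ∃ (a : T.carrier) (l' m : List T.carrier), l = l' ++ a :: m ∧
            (y < (a : WithBot T.carrier) ∧ S.label x ≤ T.label a) ∧
            ∀ c ∈ l', ¬ (y < (c : WithBot T.carrier) ∧ S.label x ≤ T.label c) := by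
          clear hl
          induction l with
          | nil => cases hb
          | cons d l ihl =>
            by_cases hd : y < (d : WithBot T.carrier) ∧ S.label x ≤ T.label d
            · exact ⟨d, [], l, rfl, hd, by simp⟩
            · rcases List.mem_cons.1 hb with rfl | hb
              · exact absurd hxb hd
              · obtain ⟨a, l', m, rfl, ha, hc⟩ := ihl hb
                exact ⟨a, d :: l', m, rfl, ha, List.forall_mem_cons.2 ⟨hd, hc⟩⟩
        exact h ⟨l', a, m, hl' ▸ hl, hf⟩
      have := skip (m := []) hall
      rw [List.append_nil] at this
      change (respond l s).length ≤ 1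
      rw [this, respond, List.length_singleton]

end Strategy

/-- If the first player has no winning strategy, then the second player's answers make up an
embedding. -/
theorem nonempty_strategy (h : ¬ S ≤ T) : Nonempty (Strategy S T S.root ⊥) := by
  classical
  by_contra hroot
  -- A position not won by the first player has an answer after which every further move again leads
  -- to such a position. In won positions the root is a junk value.
  have step : ∀ (x : S.carrier) (y : WithBot T.carrier), ∃ b : T.carrier,
      ¬ Nonempty (Strategy S T x y) → y < b ∧ S.label x ≤ T.label b ∧
        ∀ x', x < x' → ¬ Nonempty (Strategy S T x' b) := by
    intro x y
    by_cases hxy : Nonempty (Strategy S T x y)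
    · exact ⟨T.root, fun h => absurd hxy h⟩
    · by_contra! hcon
      choose next lt_next sub using fun b hb hl => (hcon b).2 hb hl
      exact hxy ⟨.mk x y next lt_next fun b hb hl => (sub b hb hl).some⟩
  choose g hg using step
  choose! p hpx hp using fun x (hx : x ≠ S.root) => S.exists_predecessor hx
  let F : ∀ x, (∀ z, z < x → T.carrier) → T.carrier := fun x ih =>
    if hx : x = S.root then g x ⊥ else g x (ih (p x) (hpx x hx))
  let f := S.wellFounded_lt.fix F
  have hf : ∀ x, f x = if x = S.root then g x ⊥ else g x (f (p x)) := fun x => by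
    change S.wellFounded_lt.fix F x = _
    rw [WellFounded.fix_eq]
    by_cases hx : x = S.root <;> simp [F, hx, f]
  have inv : ∀ x, S.label x ≤ T.label (f x) ∧ (∀ x', x < x' → ¬ Nonempty (Strategy S T x' (f x))) ∧
      (x ≠ S.root → f (p x) < f x) := by
    intro x
    induction x using S.wellFounded_lt.induction with
    | _ x ih =>
      rw [hf x]
      split_ifs with hx
      · subst hx
        obtain ⟨-, h₁, h₂⟩ := hg S.root ⊥ hroot
        exact ⟨h₁, h₂, fun h => absurd rfl h⟩
      · obtain ⟨h₀, h₁, h₂⟩ := hg x (f (p x)) ((ih (p x) (hpx x hx)).2.1 x (hpx x hx))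
        exact ⟨h₁, h₂, fun _ => WithBot.coe_lt_coe.1 h₀⟩
  refine h ⟨f, fun z x => ?_, fun x => (inv x).1⟩
  induction x using S.wellFounded_lt.induction with
  | _ x ih =>
    intro hzx
    have hx : x ≠ S.root := fun hx => (S.root_le z).not_gt (hx ▸ hzx)
    refine lt_of_le_of_lt ?_ ((inv x).2.2 hx)
    rcases (hp x hx z hzx).eq_or_lt with rfl | hlt
    · exact le_rfl
    · exact (ih (p x) (hpx x hx) hlt).le

end LabelledTree

/-! ### Simultaneous play along a bad sequence of trees -/

namespace LabelledTree

variable {Q : Type u} [Preorder Q]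

/-- A winning strategy for the first player, for each pair `S ≰ T`. -/
noncomputable def strategy {S T : LabelledTree.{u, v} Q} (h : ¬ S ≤ T) :
    Strategy S T S.root ⊥ :=
  (nonempty_strategy h).some

variable {A : Set (LabelledTree.{u, v} Q)}

/-- In the games on all the pairs of consecutive trees played at once, where the moves of the first
player in one game serve as the moves of the second player in the preceding one, the moves on the
first tree that are available after `n` rounds. -/
noncomputable def moves : ℕ → ∀ X : BadSeq A, List (X.1 0).1.carrier
  | 0, _ => []
  | n + 1, X => Strategy.respond (moves n X.shift) (strategy (X.2 0))

theorem moves_succ (n : ℕ) (X : BadSeq A) :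
    moves (n + 1) X = Strategy.respond (moves n X.shift) (strategy (X.2 0)) := rfl

theorem moves_prefix_succ (n : ℕ) (X : BadSeq A) : moves n X <+: moves (n + 1) X := by
  induction n generalizing X with
  | zero => exact List.nil_prefix
  | succ n ih => exact Strategy.respond_prefix (ih X.shift) _

theorem moves_prefix {m n : ℕ} (h : m ≤ n) (X : BadSeq A) : moves m X <+: moves n X := by
  induction n, h using Nat.le_induction with
  | base => exact List.prefix_rfl
  | succ n _ ih => exact ih.trans (moves_prefix_succ n X)

theorem moves_pairwise (n : ℕ) (X : BadSeq A) : (moves n X).Pairwise (· < ·) := by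
  cases n with
  | zero => exact .nil
  | succ n => exact (Strategy.pairwise_respond _ _).1

/-- The moves on the second tree form a chain of lists, so the responses to them have bounded length
even if that chain itself is not known to stabilise. -/
theorem exists_moves_eq (X : BadSeq A) : ∃ n, ∀ m ≥ n, moves m X = moves n X := by
  obtain ⟨N, hN⟩ := (strategy (X.2 0)).bddAbove_length_respond
    (Set.range fun n => moves n X.shift) (by
      rintro _ ⟨m, rfl⟩ _ ⟨n, rfl⟩
      exact (le_total m n).imp (fun h => moves_prefix h _) (fun h => moves_prefix h _))
  have hbdd : BddAbove (Set.range fun n => (moves n X).length) := by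
    refine ⟨N, ?_⟩
    rintro _ ⟨n, rfl⟩
    exact (moves_prefix_succ n X).length_le.trans (hN _ ⟨n, rfl⟩)
  obtain ⟨n, hn⟩ := Nat.sSup_mem (Set.range_nonempty _) hbdd
  refine ⟨n, fun m hm => ((moves_prefix hm X).eq_of_length_le ?_).symm⟩
  exact (le_csSup hbdd ⟨m, rfl⟩).trans hn.ge

/-- The sequence of all moves on the first tree. -/
noncomputable def allMoves (X : BadSeq A) : List (X.1 0).1.carrier :=
  moves (exists_moves_eq X).choose X

theorem eventually_moves_eq (X : BadSeq A) : ∃ n, ∀ m ≥ n, moves m X = allMoves X :=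
  ⟨_, (exists_moves_eq X).choose_spec⟩

theorem allMoves_eq_respond (X : BadSeq A) :
    allMoves X = Strategy.respond (allMoves X.shift) (strategy (X.2 0)) := by
  obtain ⟨m, hm⟩ := eventually_moves_eq X
  obtain ⟨n, hn⟩ := eventually_moves_eq X.shift
  rw [← hm (max m n + 1) (by omega), ← hn (max m n) (by omega), moves_succ]

theorem allMoves_ne_nil (X : BadSeq A) : allMoves X ≠ [] := by
  rw [allMoves_eq_respond]
  exact Strategy.respond_ne_nil _ _

/-- The labels met at all moves on the first tree. -/
noncomputable def allLabels (X : BadSeq A) : List Q := (allMoves X).map (X.1 0).1.label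

theorem allLabels_ne_nil (X : BadSeq A) : allLabels X ≠ [] := by
  simpa [allLabels] using allMoves_ne_nil X

/-- The label met at the last move on the first tree. -/
noncomputable def lastLabel (X : BadSeq A) : Q := (allLabels X).getLast (allLabels_ne_nil X)

/-- A comparison of the last labels would complete the domination of the truncated lists to one of
the whole response, against `not_sublistForall₂_respond`. -/
theorem not_lastLabel_le {X : BadSeq A}
    (h : List.SublistForall₂ (· ≤ ·) (allLabels X).dropLast (allLabels X.shift).dropLast) :
    ¬ lastLabel X ≤ lastLabel X.shift := by
  intro hle
  refine Strategy.not_sublistForall₂_respond (l := allMoves X.shift) (moves_pairwise _ _)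
    (fun _ _ => WithBot.bot_lt_coe _) (strategy (X.2 0)) ?_
  rw [← allMoves_eq_respond]
  obtain ⟨l, h₁, h₂⟩ := List.sublistForall₂_iff.1 h
  have key : List.SublistForall₂ (· ≤ ·) (allLabels X) (allLabels X.shift) := by
    rw [← List.dropLast_append_getLast (allLabels_ne_nil X),
      ← List.dropLast_append_getLast (allLabels_ne_nil X.shift)]
    exact List.sublistForall₂_iff.2 ⟨l ++ [lastLabel X.shift],
      List.rel_append h₁ (.cons hle .nil), h₂.append_right _⟩
  rw [allLabels, allLabels] at key
  rw [List.sublistForall₂_map_left_iff, List.sublistForall₂_map_right_iff] at key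
  exact key

/-- Otherwise, along the whole orbit, the last move would never be reached: by induction on the
number of rounds, simultaneous play stays within the truncated lists. -/
theorem exists_iterate_sublistForall₂ (X : BadSeq A) :
    ∃ n, List.SublistForall₂ (· ≤ ·) (allLabels (BadSeq.shift^[n] X)).dropLast
      (allLabels (BadSeq.shift^[n] X).shift).dropLast := by
  by_contra! h
  have key : ∀ m n, moves m (BadSeq.shift^[n] X) <+: (allMoves (BadSeq.shift^[n] X)).dropLast := by
    intro m
    induction m with
    | zero => exact fun n => List.nil_prefix
    | succ m ih =>
      intro n
      have hn := h n
      have ihn := ih (n + 1)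
      rw [Function.iterate_succ_apply'] at ihn
      generalize BadSeq.shift^[n] X = Y at hn ihn ⊢
      let s := strategy (Y.2 0)
      have h₁ : Strategy.respond (allMoves Y.shift).dropLast s <+: allMoves Y := by
        rw [allMoves_eq_respond Y]
        exact Strategy.respond_prefix (List.dropLast_prefix _) s
      refine (Strategy.respond_prefix ihn s).trans ?_
      rcases List.prefix_or_prefix_of_prefix h₁ (List.dropLast_prefix (allMoves Y)) with h₂ | h₂
      · exact h₂
      -- Were the truncated list a proper initial segment of the response to the next truncated
      -- list, it would be dominated by a subsequence of the latter.
      · by_cases heq : (allMoves Y).dropLast = Strategy.respond (allMoves Y.shift).dropLast s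
        · rw [← heq]
        · refine absurd ?_ hn
          rw [allLabels, allLabels, ← List.map_dropLast, ← List.map_dropLast,
            List.sublistForall₂_map_left_iff, List.sublistForall₂_map_right_iff]
          exact Strategy.sublistForall₂_of_prefix_respond s h₂ heq
  obtain ⟨m, hm⟩ := eventually_moves_eq X
  have := (key m 0).length_le
  have hpos := List.length_pos_of_ne_nil (allMoves_ne_nil X)
  rw [Function.iterate_zero_apply, hm m le_rfl, List.length_dropLast] at this
  omega

/-- Moves for different `X` live in different trees, so their dependence on finitely many terms
needs heterogeneous equality until labels in `Q` are taken. -/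
theorem respond_heq {S S' T T' : LabelledTree.{u, v} Q} (hS : S = S') (hT : T = T')
    (h : ¬ S ≤ T) (h' : ¬ S' ≤ T') {l : List T.carrier} {l' : List T'.carrier} (hl : l ≍ l') :
    Strategy.respond l (strategy h) ≍ Strategy.respond l' (strategy h') := by
  subst hS hT hl
  rfl

theorem moves_heq {n : ℕ} {X Y : BadSeq A} (h : ∀ i < n + 1, X.1 i = Y.1 i) :
    moves n X ≍ moves n Y := by
  induction n generalizing X Y with
  | zero =>
    have h₀ := h 0 Nat.one_pos
    change ([] : List (X.1 0).1.carrier) ≍ ([] : List (Y.1 0).1.carrier)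
    rw [h₀]
  | succ n ih =>
    exact respond_heq (congrArg Subtype.val (h 0 (by omega)))
      (congrArg Subtype.val (h 1 (by omega))) _ _
      (ih fun i hi => h (i + 1) (by omega))

/-- The labels met on the first tree within `n` rounds. -/
noncomputable def labels (n : ℕ) (X : BadSeq A) : List Q := (moves n X).map (X.1 0).1.label

theorem labels_congr {n : ℕ} (X Y : BadSeq A) (h : ∀ i < n + 1, X.1 i = Y.1 i) :
    labels n X = labels n Y := by
  have aux : ∀ {S T : LabelledTree.{u, v} Q} (_ : S = T) {l : List S.carrier} {m : List T.carrier},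
      l ≍ m → l.map S.label = m.map T.label := by
    rintro S _ rfl l _ ⟨⟩
    rfl
  exact aux (congrArg Subtype.val (h 0 (by omega))) (moves_heq h)

theorem eventually_labels_eq (X : BadSeq A) : ∃ n, ∀ m ≥ n, labels m X = allLabels X := by
  obtain ⟨n, hn⟩ := eventually_moves_eq X
  exact ⟨n, fun m hm => by rw [labels, hn m hm, allLabels]⟩

theorem countable_range_allLabels (hA : A.Countable) :
    (Set.range (allLabels : BadSeq A → List Q)).Countable := by
  have := hA.to_subtype
  refine (Set.countable_iUnion fun n =>
    BadSeq.countable_range_of_forall_lt (labels_congr (A := A) (n := n))).mono ?_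
  rintro _ ⟨X, rfl⟩
  obtain ⟨n, hn⟩ := eventually_labels_eq X
  exact Set.mem_iUnion.2 ⟨n, X, hn n le_rfl⟩

theorem measurable_allLabels : @Measurable (BadSeq A) (List Q) _ ⊤ allLabels := by
  intro s _
  have h : allLabels ⁻¹' s = ⋃ n, ⋂ m ≥ n, (labels m : BadSeq A → List Q) ⁻¹' s := by
    ext X
    obtain ⟨n, hn⟩ := eventually_labels_eq X
    simp only [Set.mem_iUnion, Set.mem_iInter, Set.mem_preimage]
    refine ⟨fun hX => ⟨n, fun m hm => (hn m hm).symm ▸ hX⟩, fun ⟨k, hk⟩ => ?_⟩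
    rw [← hn (max n k) (le_max_left _ _)]
    exact hk _ (le_max_right _ _)
  rw [h]
  exact .iUnion fun n => .iInter fun m => .iInter fun _ =>
    BadSeq.measurable_of_forall_lt (labels_congr (n := m)) trivial

end LabelledTree

/-! ### Colouring the bad sequences of trees -/

theorem theorem3p10 {Q : Type u} [Preorder Q] (hQ : IsThin Q) :
    IsThin (LabelledTree.{u, v} Q) := by
  classical
  rw [isThin_iff] at hQ ⊢
  intro A hA
  have := hA.to_subtype
  let L : BadSeq A → List Q := LabelledTree.allLabels
  let q : BadSeq A → Q := LabelledTree.lastLabel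
  have hS : Measurable (BadSeq.shift : BadSeq A → BadSeq A) := BadSeq.measurable_shift
  have hL : @Measurable _ _ _ ⊤ L := LabelledTree.measurable_allLabels
  have hLc : (Set.range L).Countable := LabelledTree.countable_range_allLabels hA
  have hqL : ∀ X, some (q X) = (L X).getLast? := fun X =>
    (List.getLast?_eq_some_getLast _).symm
  have hqm : @Measurable _ _ _ ⊤ q := fun s _ => by
    have : q ⁻¹' s = L ⁻¹' {l | ∃ a ∈ s, l.getLast? = some a} := by
      ext X
      simp [← hqL]
    rw [this]
    exact hL trivial
  have hqc : (Set.range q).Countable := by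
    refine ((hLc.image List.getLast?).preimage (Option.some_injective _)).mono ?_
    rintro _ ⟨X, rfl⟩
    exact ⟨L X, ⟨X, rfl⟩, (hqL X).symm⟩
  let D : Set (BadSeq A) :=
    {X | List.SublistForall₂ (· ≤ ·) (L X).dropLast (L X.shift).dropLast}
  -- Only countably many label lists occur, so `D` is a countable union over pairs of lists.
  have hD : MeasurableSet D := by
    have : D = ⋃ l ∈ Set.range L, ⋃ m ∈ Set.range L, ⋃ (_ : List.SublistForall₂ (· ≤ ·)
        l.dropLast m.dropLast), L ⁻¹' {l} ∩ BadSeq.shift ⁻¹' (L ⁻¹' {m}) := by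
      ext X
      simp only [Set.mem_iUnion]
      constructor
      · exact fun h => ⟨_, ⟨X, rfl⟩, _, ⟨X.shift, rfl⟩, h, rfl, rfl⟩
      · rintro ⟨l, -, m, -, h, rfl, rfl⟩
        exact h
    rw [this]
    exact .biUnion hLc fun l _ => .biUnion hLc fun m _ => .iUnion fun _ =>
      (hL trivial).inter (hS (hL trivial))
  obtain ⟨c, hc, hcX⟩ := hQ (Set.range q) hqc
  have := hqc.to_subtype
  let bad : BadSeq A → Prop := fun X => ∀ n, BadSeq.shift^[n] X ∈ D
  have hbad : MeasurableSet {X | bad X} := by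
    rw [show {X | bad X} = ⋂ n, BadSeq.shift^[n] ⁻¹' D by ext; simp [bad]]
    exact .iInter fun n => (hS.iterate n) hD
  let F : {X // bad X} → BadSeq (Set.range q) := fun X =>
    ⟨fun k => ⟨q (BadSeq.shift^[k] X.1), _, rfl⟩, fun k => by
      change ¬ q (BadSeq.shift^[k] X.1) ≤ q (BadSeq.shift^[k + 1] X.1)
      rw [Function.iterate_succ_apply']
      exact LabelledTree.not_lastLabel_le (X.2 k)⟩
  have hF : Measurable F := BadSeq.measurable_mk fun k s _ => by
    have h : Measurable fun X : {X // bad X} => BadSeq.shift^[k] X.1 :=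
      (hS.iterate k).comp measurable_subtype_coe
    have h' := h (hqm (t := Subtype.val '' s) trivial)
    convert h' using 1
    ext X
    simp [F]
  have hc₁ : Measurable fun X => if h : bad X then c (F ⟨X, h⟩) else 0 :=
    Measurable.dite (hc.comp hF) measurable_const hbad
  -- A constant serves as second colouring, since no orbit avoids `D`.
  refine exists_coloring_of_split hS hD hc₁ (fun X hX => ?_) (c₂ := fun _ => 0) measurable_const
    fun X hX => ?_
  · have hX' : bad X := hX
    have hX'' : bad X.shift := fun n => hX (n + 1)
    rw [dif_pos hX', dif_pos hX'']
    exact hcX (F ⟨X, hX'⟩)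
  · obtain ⟨n, hn⟩ := LabelledTree.exists_iterate_sublistForall₂ X
    exact absurd hn (hX n)
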